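/- Let $\mathbb{F}$ be a finite field. For an irreducible monic $Q \in \mathbb{F}[t]$ write $\mathbb{F}_q = \mathbb{F}[t]/Q\mathbb{F}[t]$, a field with $q = |\mathbb{F}|^{\deg Q}$ elements; a polynomial $P \in (\mathbb{F}[t])[x]$ defines a function $P : \mathbb{F}_q \to \mathbb{F}_q$ by reducing its coefficients mod $Q$. For a function $f$ on $\mathbb{F}((t^{-1}))$ put $\partial_u f(x) = f(x+u) - f(x)$ and $\partial_{u_1,\dots,u_m} = \partial_{u_m}\partial_{u_1,\dots,u_{m-1}}$. The derivational degree of $P \in (\mathbb{F}[t])[x]$ is the least $m \ge 0$ such that $\partial_{u_1,\dots,u_{m+1}}P(y) = 0$ for all $u_1,\dots,u_{m+1},y \in \mathbb{F}((t^{-1}))$. Let $P_1,P_2,P_3 \in (\mathbb{F}[t])[x]$ be nonconstant (in $x$) with $P_i(0)=0$, of degrees $d_i$ and derivational degrees $k_i$. Let $H_q = H_{q,1}+H_{q,2}+H_{q,3} \le (\mathbb{F}_q,+)$, where $H_{q,i}$ is the subgroup generated by $\{P_i(x) : x \in \mathbb{F}_q\}$, and let $\gamma = \min_i 2^{-(k_i-1)}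 > 0$. Then for every $Q$ and every $c \in H_q$, $$\left|\{(x,y,z)\in\mathbb{F}_q^3 : P_1(x)+P_2(y)+P_3(z)=c\}\right| = \frac{q^3}{|H_q|} + O\left(q^{2-\gamma}\right)$$ as $q \to \infty$. More precisely, there is a constant $C = C(d_1,d_2,d_3,k_1,k_2,k_3)$, independent of $\mathbb{F}$ and otherwise of the $P_i$, such that the error is at most $Cq^{2-\gamma}$ in absolute value for all $Q$ with $q \ge q_0(P_1,P_2,P_3)$ and all $c \in H_q$, and there is a constant $C' = C'(P_1,P_2,P_3)$ such that it is at most $C'q^{2-\gamma}$ for all $Q$ and all $c \in H_q$. In particular, there is $q_1 = q_1(P_1,P_2,P_3)$ such that, whenever $q \ge q_1$, $$P_1(\mathbb{F}_q)+P_2(\mathbb{F}_q)+P_3(\mathbb{F}_q) = H_q.$$ -/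

import Mathlib

open Polynomial
open scoped Pointwise

noncomputable section

/-- The embedding `F[t] → F((t⁻¹))`. The formal variable of `LaurentSeries F` plays the role of
`t⁻¹`, so `t` is sent to its inverse. -/
def polyToLaurentInfty (F : Type*) [Field F] : F[X] →+* LaurentSeries F :=
  Polynomial.eval₂RingHom (HahnSeries.C : F →+* LaurentSeries F)
    (HahnSeries.single (-1 : ℤ) (1 : F))

/-- The iterated difference `∂_{u₁, …, uₘ} f`, where `∂_u f (x) = f (x + u) - f x` and
`∂_{u₁, …, uₘ} = ∂_{uₘ} ∂_{u₁, …, uₘ₋₁}`. -/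
def iterDiff {L : Type*} [AddCommGroup L] (us : List L) (f : L → L) : L → L :=
  us.foldl (fun g u => fwdDiff u g) f

/-- The derivational degree of `P ∈ (F[t])[x]`: the least `m ≥ 0` such that
`∂_{u₁, …, uₘ₊₁} P (y) = 0` for all `u₁, …, uₘ₊₁, y ∈ F((t⁻¹))`. -/
def derivationalDegree {F : Type*} [Field F] (P : F[X][X]) : ℕ :=
  sInf {m : ℕ | ∀ us : List (LaurentSeries F), us.length = m + 1 →
    ∀ y : LaurentSeries F, iterDiff us (fun x => P.eval₂ (polyToLaurentInfty F) x) y = 0}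

/-- The quotient ring `F[t] / Q F[t]`; it is a finite field if `F` is a finite field and `Q` is
irreducible. -/
abbrev PolyMod {F : Type*} [Field F] (Q : F[X]) : Type _ := F[X] ⧸ Ideal.span {Q}

/-- The function `x ↦ P(x)` on `F[t] / Q F[t]`, the coefficients of `P` being reduced mod `Q`. -/
def polyFun {F : Type*} [Field F] (Q : F[X]) (P : F[X][X]) (x : PolyMod Q) : PolyMod Q :=
  P.eval₂ (Ideal.Quotient.mk (Ideal.span {Q})) x

/-- The subgroup of `(F[t] / Q F[t], +)` which is the sum over `i` of the subgroups generated by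
the values of `P i`. -/
def valueSubgroup {F : Type*} [Field F] (Q : F[X]) (P : Fin 3 → F[X][X]) :
    AddSubgroup (PolyMod Q) :=
  ⨆ i, AddSubgroup.closure (Set.range (polyFun Q (P i)))

/-- The number of `(x, y, z) ∈ (F[t] / Q F[t])³` with `P₀(x) + P₁(y) + P₂(z) = c`. -/
def solutionCount {F : Type*} [Field F] (Q : F[X]) (P : Fin 3 → F[X][X]) (c : PolyMod Q) : ℕ :=
  Nat.card {v : PolyMod Q × PolyMod Q × PolyMod Q //
    polyFun Q (P 0) v.1 + polyFun Q (P 1) v.2.1 + polyFun Q (P 2) v.2.2 = c}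

/-- The exponent `γ = min_i 1 / 2 ^ (k i - 1)`. -/
def savingExponent (k : Fin 3 → ℕ) : ℝ := ⨅ i, 1 / 2 ^ (k i - 1)

end

/-! ### Base-`p` digit sums and binomial coefficients mod `p` -/

section DigitSum

/-! Fourier analysis on `PolyMod Q` writes the count as an average over additive characters `χ` of a
product of three sums `∑ x, χ (P i x)`. Characters trivial on `H_q` give exactly `q ^ 3 / |H_q|`.
Any other `χ` is nontrivial on a value of some `P i`, and for that `i` a Weyl bound saves `q ^ γ`;
the other two factors are controlled by the second moment, since fibres of `P i` have boundedly many
points (`abs_card_solutions_sub_le`).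

The Weyl bound depends on the derivational degree rather than the degree, through base-`p` digit
sums of exponents, `p` being the characteristic. By Kummer and Lucas, a difference strictly lowers
the digit sums, and a suitable one lowers a given digit sum by exactly one; so no exponent of `P`
has digit sum above the derivational degree (`digits_sum_le_derivationalDegree`). In
`norm_sum_addChar_reduced_le`, exponents are first made prime to `p` using a Frobenius-invariant
character. One differencing step then costs one unit of digit sum, and for all but boundedly many
shifts the reduced difference keeps a nonzero linear term, so it is nonconstant and the induction
continues down to a linear polynomial, whose sum vanishes. -/

theorem digits_sum_eq_mod_add_div {p : ℕ} (hp : 1 < p) (n : ℕ) :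
    (p.digits n).sum = n % p + (p.digits (n / p)).sum := by
  rcases Nat.eq_zero_or_pos n with rfl | hn
  · simp
  · rw [Nat.digits_def' hp hn, List.sum_cons]

theorem digits_sum_base_mul {p : ℕ} (hp : 1 < p) (n : ℕ) :
    (p.digits (p * n)).sum = (p.digits n).sum := by
  rw [digits_sum_eq_mod_add_div hp, Nat.mul_mod_right, Nat.mul_div_cancel_left _ (by omega), zero_add]

theorem digits_sum_base_pow_mul {p : ℕ} (hp : 1 < p) (v n : ℕ) :
    (p.digits (p ^ v * n)).sum = (p.digits n).sum := by
  induction v with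
  | zero => simp
  | succ v ih => rw [pow_succ', mul_assoc, digits_sum_base_mul hp, ih]

theorem digits_sum_pos {p : ℕ} (hp : 1 < p) {n : ℕ} (hn : 0 < n) : 0 < (p.digits n).sum := by
  induction n using Nat.strong_induction_on with
  | _ n ih =>
    rw [digits_sum_eq_mod_add_div hp]
    rcases Nat.eq_zero_or_pos (n % p) with h | h
    · have h1 : 0 < n / p := Nat.div_pos (Nat.le_of_dvd hn (Nat.dvd_of_mod_eq_zero h)) (by omega)
      have := ih _ (Nat.div_lt_self hn hp) h1
      omega
    · omega

/-- By Kummer, the binomial coefficient is prime to `p` only if adding `j` and `n - j` produces no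
carry, so their digit sums add up. -/
theorem digits_sum_lt_of_not_dvd_choose {p : ℕ} [Fact p.Prime] {j n : ℕ} (hj : j < n)
    (h : ¬ p ∣ n.choose j) : (p.digits j).sum < (p.digits n).sum := by
  have h1 := sub_one_mul_padicValNat_choose_eq_sub_sum_digits (p := p) hj.le
  rw [padicValNat.eq_zero_of_not_dvd h, mul_zero] at h1
  have := digits_sum_pos (p := p) (Fact.out : p.Prime).one_lt (Nat.sub_pos_of_lt hj)
  omega

theorem digits_sum_of_not_dvd {p : ℕ} (hp : 1 < p) {n : ℕ} (h : ¬ p ∣ n) :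
    (p.digits n).sum = (p.digits (n - 1)).sum + 1 := by
  have h0 : n % p ≠ 0 := fun h0 => h (Nat.dvd_of_mod_eq_zero h0)
  have h1 : n - 1 = (n % p - 1) + p * (n / p) := by
    have := Nat.mod_add_div n p
    omega
  have h2 : n % p - 1 < p := by
    have := Nat.mod_lt n (show p > 0 by omega)
    omega
  rw [digits_sum_eq_mod_add_div hp n, digits_sum_eq_mod_add_div hp (n - 1), h1,
    Nat.add_mul_mod_self_left, Nat.add_mul_div_left _ _ (by omega), Nat.mod_eq_of_lt h2,
    Nat.div_eq_of_lt h2, zero_add]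
  omega

/-- Lower the last nonzero digit of `n` by one: if `p ∤ n` take `n - 1`, otherwise pass to `n / p`
by Lucas. -/
theorem exists_digits_sum_eq_add_one {p : ℕ} [hp : Fact p.Prime] {n : ℕ} (hn : 0 < n) :
    ∃ j < n, ¬ p ∣ n.choose j ∧ (p.digits n).sum = (p.digits j).sum + 1 := by
  induction n using Nat.strong_induction_on with
  | _ n ih =>
    by_cases h : p ∣ n
    · obtain ⟨m, rfl⟩ := h
      have hm : 0 < m := Nat.pos_of_mul_pos_left hn
      obtain ⟨j, hj, hc, hs⟩ := ih m (by nlinarith [hp.out.one_lt]) hm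
      refine ⟨p * j, Nat.mul_lt_mul_of_pos_left hj hp.out.pos, ?_, ?_⟩
      · have := Choose.choose_modEq_choose_mod_mul_choose_div_nat (n := p * m) (k := p * j) (p := p)
        simp only [Nat.mul_mod_right, Nat.choose_self, one_mul,
          Nat.mul_div_cancel_left _ hp.out.pos] at this
        rwa [(this.dvd_iff dvd_rfl)]
      · rw [digits_sum_base_mul hp.out.one_lt, digits_sum_base_mul hp.out.one_lt, hs]
    · refine ⟨n - 1, by omega, ?_, digits_sum_of_not_dvd hp.out.one_lt h⟩
      obtain ⟨m, rfl⟩ : ∃ m, n = m + 1 := ⟨n - 1, by omega⟩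
      simpa using h

end DigitSum

/-! ### Differences of polynomials and digit sums of exponents -/

section Difference

variable {R : Type*} [CommRing R]

/-- The coefficient of `x ^ j` in `P (x + u) - P x`, as a polynomial in `u`. -/
noncomputable def diffCoeff (P : R[X]) (j : ℕ) : R[X] := hasseDeriv j P - C (P.coeff j)

theorem coeff_taylor_sub (P : R[X]) (u : R) (j : ℕ) :
    (taylor u P - P).coeff j = (diffCoeff P j).eval u := by
  simp [diffCoeff, taylor_coeff]

theorem coeff_diffCoeff_of_pos (P : R[X]) (j : ℕ) {i : ℕ} (hi : 0 < i) :
    (diffCoeff P j).coeff i = ((i + j).choose j : R) * P.coeff (i + j) := by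
  simp [diffCoeff, hasseDeriv_coeff, coeff_C, hi.ne']

theorem coeff_diffCoeff_zero (P : R[X]) (j : ℕ) : (diffCoeff P j).coeff 0 = 0 := by
  simp [diffCoeff, hasseDeriv_coeff]

theorem natDegree_diffCoeff_le (P : R[X]) (j : ℕ) :
    (diffCoeff P j).natDegree ≤ P.natDegree - j := by
  refine (natDegree_sub_le _ _).trans ?_
  simpa using natDegree_hasseDeriv_le P j

theorem exists_of_coeff_taylor_sub_ne_zero {p : ℕ} [CharP R p] {P : R[X]} {u : R} {j : ℕ}
    (h : (taylor u P - P).coeff j ≠ 0) : ∃ n, j < n ∧ P.coeff n ≠ 0 ∧ ¬ p ∣ n.choose j := by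
  rw [coeff_taylor_sub] at h
  have h0 : diffCoeff P j ≠ 0 := by
    rintro h0
    simp [h0] at h
  obtain ⟨i, hi⟩ : ∃ i, (diffCoeff P j).coeff i ≠ 0 := by
    by_contra! hc
    exact h0 (Polynomial.ext (by simpa using hc))
  have hpos : 0 < i := Nat.pos_of_ne_zero fun h => hi (h ▸ coeff_diffCoeff_zero P j)
  rw [coeff_diffCoeff_of_pos P j hpos] at hi
  refine ⟨i + j, by omega, right_ne_zero_of_mul hi, fun hd => left_ne_zero_of_mul hi ?_⟩
  rwa [CharP.cast_eq_zero_iff R p]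

theorem digits_sum_lt_of_coeff_taylor_sub_ne_zero {p : ℕ} [Fact p.Prime] [CharP R p] {P : R[X]}
    {k : ℕ} (hP : ∀ n, P.coeff n ≠ 0 → (p.digits n).sum < k + 1) {u : R} {j : ℕ}
    (h : (taylor u P - P).coeff j ≠ 0) : (p.digits j).sum < k := by
  obtain ⟨n, hn, hc, hd⟩ := exists_of_coeff_taylor_sub_ne_zero (p := p) h
  have := digits_sum_lt_of_not_dvd_choose hn hd
  have := hP n hc
  omega

theorem natDegree_taylor_sub_le (P : R[X]) (u : R) : (taylor u P - P).natDegree ≤ P.natDegree :=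
  (natDegree_sub_le _ _).trans (by simp)

theorem fwdDiff_eval (P : R[X]) (u : R) :
    fwdDiff u (fun x => P.eval x) = fun x => (taylor u P - P).eval x := by
  ext x
  simp [fwdDiff, taylor_eval]

theorem iterDiff_cons {L : Type*} [AddCommGroup L] (u : L) (us : List L) (f : L → L) :
    iterDiff (u :: us) f = iterDiff us (fwdDiff u f) := rfl

theorem iterDiff_eval_eq_zero {m : ℕ} {P : R[X]} (hP : P.degree < m) {us : List R}
    (hus : us.length = m) (y : R) : iterDiff us (fun x => P.eval x) y = 0 := by
  induction us generalizing m P with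
  | nil =>
    subst hus
    have : P = 0 := by simpa using hP
    simp [this, iterDiff]
  | cons u us ih =>
    rw [iterDiff_cons, fwdDiff_eval]
    refine ih (m := us.length) ?_ rfl
    subst hus
    rcases eq_or_ne P 0 with rfl | h0
    · simp
    · have h1 : (taylor u P - P).degree < P.degree := by
        rw [← degree_taylor P u]
        refine degree_sub_lt_left (by simp) (by simpa using h0) (by simp)
      rw [List.length_cons] at hP
      have h2 : P.degree ≤ us.length := by
        rw [degree_eq_natDegree h0] at hP ⊢
        exact_mod_cast Nat.lt_succ_iff.mp (by exact_mod_cast hP)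
      exact h1.trans_le h2

/-- Some shift leaves a term of digit sum exactly one less: its coefficient is a polynomial in the
shift containing a nonzero multiple of `P.coeff n`, so it cannot vanish on an infinite field. -/
theorem digits_sum_lt_of_iterDiff_eq_zero {K : Type*} [Field K] [Infinite K] {p : ℕ}
    [hp : Fact p.Prime] [CharP K p] {m : ℕ} {P : K[X]}
    (h : ∀ us : List K, us.length = m → ∀ y, iterDiff us (fun x => P.eval x) y = 0)
    {n : ℕ} (hn : P.coeff n ≠ 0) (hpos : 0 < n) : (p.digits n).sum < m := by
  induction m generalizing P n with
  | zero =>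
    have : P = 0 := funext fun y => by simpa [iterDiff] using h [] rfl y
    simp [this] at hn
  | succ m ih =>
    obtain ⟨j, hj, hc, hs⟩ := exists_digits_sum_eq_add_one (p := p) hpos
    -- The induction hypothesis needs a positive exponent. If `j = 0`, then `n` has digit sum one,
    -- and only the case of a single difference, where `P` would be constant, needs an argument.
    rcases Nat.eq_zero_or_pos j with rfl | hj0
    · rcases Nat.eq_zero_or_pos m with rfl | hm
      · exfalso
        have hconst : ∀ u, P.eval u = P.eval 0 := fun u => by
          have := h [u] rfl 0
          rw [iterDiff_cons, fwdDiff_eval] at this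
          simpa [iterDiff, taylor_eval, sub_eq_zero] using this
        have : P = C (P.eval 0) := funext fun y => by simpa using hconst y
        rw [this, coeff_C, if_neg hpos.ne'] at hn
        exact hn rfl
      · simp at hs
        omega
    obtain ⟨u, hu⟩ : ∃ u, (taylor u P - P).coeff j ≠ 0 := by
      by_contra! hz
      have h0 : diffCoeff P j = 0 := funext fun u => by
        rw [← coeff_taylor_sub, hz, eval_zero]
      have h1 := coeff_diffCoeff_of_pos P j (i := n - j) (by omega)
      rw [h0, coeff_zero, Nat.sub_add_cancel hj.le] at h1
      refine mul_ne_zero ?_ hn h1.symm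
      rwa [Ne, CharP.cast_eq_zero_iff K p]
    have := ih (P := taylor u P - P) (fun us hus y => by
      have := h (u :: us) (by simp [hus]) y
      rwa [iterDiff_cons, fwdDiff_eval] at this) hu hj0
    omega

end Difference

/-! ### Derivational degree bounds digit sums -/

section DerivationalDegree

variable {F : Type*} [Field F]

theorem polyToLaurentInfty_coeff (P : F[X]) (n : ℕ) :
    (polyToLaurentInfty F P).coeff (-(n : ℤ)) = P.coeff n := by
  induction P using Polynomial.induction_on' with
  | add P Q hP hQ => simp [hP, hQ]
  | monomial m a =>
    simp only [polyToLaurentInfty, coe_eval₂RingHom, eval₂_monomial, coeff_monomial]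
    rw [HahnSeries.single_pow, HahnSeries.C_apply, HahnSeries.single_mul_single]
    rw [HahnSeries.coeff_single]
    simp [eq_comm]

theorem polyToLaurentInfty_injective : Function.Injective (polyToLaurentInfty F) := by
  intro P Q h
  ext n
  rw [← polyToLaurentInfty_coeff, h, polyToLaurentInfty_coeff]

theorem infinite_laurentSeries : Infinite (LaurentSeries F) :=
  Infinite.of_injective _ (polyToLaurentInfty_injective (F := F))

theorem digits_sum_le_derivationalDegree {p : ℕ} [hp : Fact p.Prime] [CharP F p] (P : F[X][X])
    {n : ℕ} (hn : P.coeff n ≠ 0) : (p.digits n).sum ≤ derivationalDegree P := by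
  have := infinite_laurentSeries (F := F)
  have : CharP (LaurentSeries F) p := charP_of_injective_ringHom
    (f := (polyToLaurentInfty F).comp C) (polyToLaurentInfty_injective.comp C_injective) p
  -- Nonemptiness makes the infimum an attained minimum rather than the default `0`.
  have hne : {m : ℕ | ∀ us : List (LaurentSeries F), us.length = m + 1 →
      ∀ y : LaurentSeries F,
        iterDiff us (fun x => P.eval₂ (polyToLaurentInfty F) x) y = 0}.Nonempty := by
    refine ⟨P.natDegree, fun us hus y => ?_⟩
    simp_rw [← eval_map]
    refine iterDiff_eval_eq_zero (m := P.natDegree + 1) ?_ hus y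
    exact (degree_map_le.trans degree_le_natDegree).trans_lt (by exact_mod_cast Nat.lt_succ_self _)
  have hmem := Nat.sInf_mem hne
  simp_rw [Set.mem_ofPred_eq, ← eval_map] at hmem
  rcases Nat.eq_zero_or_pos n with rfl | hpos
  · simp
  · have := digits_sum_lt_of_iterDiff_eq_zero (p := p) hmem (n := n) (by
      rw [coeff_map]
      exact (map_ne_zero_iff _ polyToLaurentInfty_injective).2 hn) hpos
    simp_rw [eval_map] at this
    exact Nat.lt_succ_iff.mp this

end DerivationalDegree

/-! ### Making exponents prime to the characteristic -/

section FrobeniusReduction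

theorem addChar_sum_congr {G ι M : Type*} [AddCommGroup G] [CommMonoid M] (ψ : AddChar G M)
    (s : Finset ι) {f g : ι → G} (h : ∀ i, ψ (f i) = ψ (g i)) :
    ψ (∑ i ∈ s, f i) = ψ (∑ i ∈ s, g i) := by
  classical
  induction s using Finset.induction_on with
  | empty => simp
  | insert a s ha ih =>
    rw [Finset.sum_insert ha, Finset.sum_insert ha, AddChar.map_add_eq_mul, AddChar.map_add_eq_mul,
      h, ih]

theorem addChar_pow_pow {K : Type*} [Field K] {p : ℕ} {ψ : AddChar K ℂ}
    (hψ : ∀ x, ψ (x ^ p) = ψ x) (v : ℕ) (x : K) : ψ (x ^ p ^ v) = ψ x := by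
  induction v with
  | zero => simp
  | succ v ih => rw [pow_succ, pow_mul, hψ, ih]

theorem natDegree_diffCoeff_pow_le {R : Type*} [CommRing R] (p J v : ℕ) (P : R[X]) :
    (diffCoeff P (p ^ v) ^ p ^ (J - v)).natDegree ≤ p ^ (J - v) * (P.natDegree - p ^ v) :=
  natDegree_pow_le.trans (Nat.mul_le_mul_left _ (natDegree_diffCoeff_le _ _))

/-- A polynomial in `u` whose value is the `p ^ J`-th power of the linear coefficient of
`frobReduce p (p ^ (J + 1)) (P (x + u) - P x)`. -/
noncomputable def linearCoeffPoly {R : Type*} [CommRing R] (p J : ℕ) (P : R[X]) : R[X] :=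
  ∑ v ∈ Finset.range (J + 1), diffCoeff P (p ^ v) ^ p ^ (J - v)

theorem natDegree_linearCoeffPoly_le {R : Type*} [CommRing R] {p : ℕ} [Fact p.Prime] (J : ℕ) (P : R[X]) :
    (linearCoeffPoly p J P).natDegree ≤ p ^ J * P.natDegree := by
  refine natDegree_sum_le_of_forall_le _ _ fun v _ => (natDegree_diffCoeff_pow_le p J v P).trans ?_
  exact Nat.mul_le_mul (Nat.pow_le_pow_right (Fact.out : p.Prime).pos (Nat.sub_le _ _))
    (Nat.sub_le _ _)

/-- Only the summand `v = 0` reaches degree `p ^ J * (P.natDegree - 1)`, and its coefficient there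
survives because `p` does not divide the degree. -/
theorem linearCoeffPoly_ne_zero {K : Type*} [Field K] {p : ℕ} [Fact p.Prime] [CharP K p] (J : ℕ)
    {P : K[X]} (h2 : 2 ≤ P.natDegree)
    (hp : ¬ p ∣ P.natDegree) : linearCoeffPoly p J P ≠ 0 := by
  have hprime : p.Prime := Fact.out
  intro h0
  have hc : (linearCoeffPoly p J P).coeff (p ^ J * (P.natDegree - 1)) =
      (P.natDegree * P.leadingCoeff) ^ p ^ J := by
    rw [linearCoeffPoly, finsetSum_coeff, Finset.sum_eq_single 0]
    · rw [pow_zero, Nat.sub_zero, coeff_pow_of_natDegree_le (natDegree_diffCoeff_le _ _),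
        coeff_diffCoeff_of_pos _ _ (by omega), Nat.sub_add_cancel (by omega), Nat.choose_one_right,
        leadingCoeff]
    · intro v hv hv0
      refine coeff_eq_zero_of_natDegree_lt ((natDegree_diffCoeff_pow_le p J v P).trans_lt ?_)
      have hv' : v ≤ J := Nat.lt_succ_iff.1 (Finset.mem_range.1 hv)
      conv_rhs => rw [← Nat.sub_add_cancel hv', pow_add, mul_assoc]
      refine Nat.mul_lt_mul_of_pos_left ?_ (pow_pos hprime.pos _)
      have h3 : 2 ≤ p ^ v := hprime.two_le.trans (Nat.le_self_pow hv0 p)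
      obtain ⟨m, hm⟩ : ∃ m, P.natDegree = m + 2 := ⟨P.natDegree - 2, by omega⟩
      have h4 : 2 * (m + 1) ≤ p ^ v * (m + 1) := Nat.mul_le_mul_right _ h3
      rw [hm, show m + 2 - 1 = m + 1 from rfl]
      omega
    · simp
  rw [h0, coeff_zero] at hc
  refine pow_ne_zero _ (mul_ne_zero ?_ ?_) hc.symm
  · rwa [Ne, CharP.cast_eq_zero_iff K p]
  · rw [leadingCoeff_ne_zero]
    rintro rfl
    simp at h2

variable {K : Type*} [Field K] [Fintype K] {p : ℕ} [Fact p.Prime] [CharP K p]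

/-- The absolute trace is Frobenius invariant, and so is a character composed with it. -/
theorem exists_addChar_frobenius_invariant :
    ∃ ψ : AddChar K ℂ, ψ ≠ 1 ∧ ∀ x, ψ (x ^ p) = ψ x := by
  obtain rfl := ringChar.eq K p
  let _ : Algebra (ZMod (ringChar K)) K := ZMod.algebra K (ringChar K)
  refine ⟨(ZMod.stdAddChar (N := ringChar K)).compAddMonoidHom
    (Algebra.trace (ZMod (ringChar K)) K).toAddMonoidHom, ?_, fun x => ?_⟩
  · obtain ⟨b, hb⟩ := FiniteField.trace_to_zmod_nondegenerate K (one_ne_zero (α := K))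
    rw [one_mul] at hb
    refine AddChar.ne_one_iff.2 ⟨b, fun h => hb ?_⟩
    refine ZMod.injective_stdAddChar ?_
    rw [AddChar.map_zero_eq_one]
    exact h
  · have h := Algebra.trace_eq_of_algEquiv
      (FiniteField.frobeniusAlgEquiv (ZMod (ringChar K)) K (ringChar K)) x
    rw [FiniteField.frobeniusAlgEquiv_apply, ZMod.card] at h
    simp [h]

theorem exists_eq_mulShift {ψ : AddChar K ℂ} (hψ : ψ ≠ 1) (χ : AddChar K ℂ) :
    ∃ a, χ = ψ.mulShift a := by
  classical
  have hinj := AddChar.to_mulShift_inj_of_isPrimitive (AddChar.IsPrimitive.of_ne_one hψ)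
  have hbij := (Fintype.bijective_iff_injective_and_card _).2
    ⟨hinj, (AddChar.card_eq (α := K)).symm⟩
  obtain ⟨a, ha⟩ := hbij.2 χ
  exact ⟨a, ha.symm⟩

variable (p) in
/-- Replace each term `a x ^ (p ^ v * m)` of degree below `N`, where `p` does not divide `m`,
by `a ^ (1 / p ^ v) x ^ m`. -/
noncomputable def frobReduce (N : ℕ) (T : K[X]) : K[X] :=
  ∑ n ∈ Finset.range N, monomial (ordCompl[p] n)
    ((iterateFrobeniusEquiv K p (n.factorization p)).symm (T.coeff n))

theorem iterateFrobeniusEquiv_symm_pow (v : ℕ) (a : K) :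
    ((iterateFrobeniusEquiv K p v).symm a) ^ p ^ v = a := by
  rw [← iterateFrobeniusEquiv_def, RingEquiv.apply_symm_apply]

theorem exists_of_coeff_frobReduce_ne_zero {N : ℕ} {T : K[X]} {m : ℕ}
    (h : (frobReduce p N T).coeff m ≠ 0) : ∃ n, n < N ∧ T.coeff n ≠ 0 ∧ ordCompl[p] n = m := by
  rw [frobReduce, finsetSum_coeff] at h
  obtain ⟨n, hn, hne⟩ := Finset.exists_ne_zero_of_sum_ne_zero h
  rw [coeff_monomial] at hne
  split_ifs at hne with hm
  · exact ⟨n, Finset.mem_range.1 hn, fun h0 => hne (by simp [h0]), hm⟩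
  · exact absurd rfl hne

theorem natDegree_frobReduce_le (N : ℕ) (T : K[X]) :
    (frobReduce p N T).natDegree ≤ T.natDegree := by
  refine natDegree_le_iff_coeff_eq_zero.2 fun m hm => ?_
  by_contra h
  obtain ⟨n, -, hc, rfl⟩ := exists_of_coeff_frobReduce_ne_zero h
  exact absurd ((Nat.div_le_self _ _).trans (le_natDegree_of_ne_zero hc)) (not_le.2 hm)

theorem not_dvd_of_coeff_frobReduce_ne_zero {N : ℕ} {T : K[X]} {m : ℕ}
    (h : (frobReduce p N T).coeff m ≠ 0) (hm : m ≠ 0) : ¬ p ∣ m := by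
  obtain ⟨n, -, -, rfl⟩ := exists_of_coeff_frobReduce_ne_zero h
  refine Nat.not_dvd_ordCompl Fact.out ?_
  rintro rfl
  simp at hm

theorem digits_sum_le_of_coeff_frobReduce_ne_zero {N : ℕ} {T : K[X]} {k : ℕ}
    (hT : ∀ n, T.coeff n ≠ 0 → (p.digits n).sum ≤ k) {m : ℕ}
    (h : (frobReduce p N T).coeff m ≠ 0) : (p.digits m).sum ≤ k := by
  obtain ⟨n, -, hc, rfl⟩ := exists_of_coeff_frobReduce_ne_zero h
  have := digits_sum_base_pow_mul (Fact.out : p.Prime).one_lt (n.factorization p) (ordCompl[p] n)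
  rw [Nat.ordProj_mul_ordCompl_eq_self] at this
  exact this ▸ hT n hc

theorem addChar_eval_frobReduce {ψ : AddChar K ℂ} (hψ : ∀ x, ψ (x ^ p) = ψ x) {N : ℕ} {T : K[X]}
    (hN : T.natDegree < N) (x : K) : ψ ((frobReduce p N T).eval x) = ψ (T.eval x) := by
  rw [eval_eq_sum_range' hN, frobReduce, eval_finsetSum]
  refine addChar_sum_congr ψ _ fun n => ?_
  rw [eval_monomial, ← addChar_pow_pow hψ (n.factorization p), mul_pow,
    iterateFrobeniusEquiv_symm_pow, ← pow_mul, mul_comm (_ / _), Nat.ordProj_mul_ordCompl_eq_self]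

/-- The terms reduced to `x` are those with exponent `p ^ v`; the additive power `p ^ J` clears all
the roots taken, giving an expression polynomial in the coefficients. -/
theorem coeff_one_frobReduce_pow (J : ℕ) (T : K[X]) :
    ((frobReduce p (p ^ (J + 1)) T).coeff 1) ^ p ^ J =
      ∑ v ∈ Finset.range (J + 1), T.coeff (p ^ v) ^ p ^ (J - v) := by
  classical
  have hp : p.Prime := Fact.out
  have hset : (Finset.range (p ^ (J + 1))).filter (fun n => ordCompl[p] n = 1) =
      (Finset.range (J + 1)).image (fun v => p ^ v) := by
    ext n
    simp only [Finset.mem_filter, Finset.mem_range, Finset.mem_image]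
    constructor
    · rintro ⟨h1, h2⟩
      have h3 := Nat.ordProj_mul_ordCompl_eq_self n p
      rw [h2, mul_one] at h3
      refine ⟨n.factorization p, ?_, h3⟩
      rw [← h3] at h1
      exact (Nat.pow_lt_pow_iff_right hp.one_lt).1 h1
    · rintro ⟨v, hv, rfl⟩
      refine ⟨Nat.pow_lt_pow_right hp.one_lt hv, ?_⟩
      rw [hp.factorization_pow, Finsupp.single_eq_same, Nat.div_self (pow_pos hp.pos _)]
  rw [frobReduce, finsetSum_coeff]
  simp_rw [coeff_monomial]
  rw [← Finset.sum_filter, hset, Finset.sum_image fun a _ b _ h => Nat.pow_right_injective hp.two_le h,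
    sum_pow_char_pow]
  refine Finset.sum_congr rfl fun v hv => ?_
  have hv' : v ≤ J := Nat.lt_succ_iff.1 (Finset.mem_range.1 hv)
  rw [hp.factorization_pow, Finsupp.single_eq_same]
  conv_lhs => rw [← Nat.add_sub_cancel' hv', pow_add, pow_mul, iterateFrobeniusEquiv_symm_pow]

theorem eval_linearCoeffPoly (J : ℕ) (P : K[X]) (u : K) :
    (linearCoeffPoly p J P).eval u =
      ((frobReduce p (p ^ (J + 1)) (taylor u P - P)).coeff 1) ^ p ^ J := by
  rw [coeff_one_frobReduce_pow, linearCoeffPoly, eval_finsetSum]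
  simp_rw [eval_pow, coeff_taylor_sub]

end FrobeniusReduction

/-! ### Weyl differencing -/

section Weyl

variable {K : Type*} [Field K] [Fintype K]

theorem sq_norm_sum_addChar_le (ψ : AddChar K ℂ) (f : K → K) :
    ‖∑ x, ψ (f x)‖ ^ 2 ≤ ∑ u, ‖∑ x, ψ (f (x + u) - f x)‖ := by
  have h : (∑ x, ψ (f x)) * (starRingEnd ℂ) (∑ x, ψ (f x)) =
      ∑ u, ∑ x, ψ (f (x + u) - f x) := by
    rw [Finset.sum_comm, map_sum, Finset.sum_mul_sum, Finset.sum_comm]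
    refine Finset.sum_congr rfl fun x _ => ?_
    refine (Equiv.sum_comp (Equiv.addLeft x) _).symm.trans (Finset.sum_congr rfl fun u _ => ?_)
    rw [Equiv.coe_addLeft, sub_eq_add_neg, AddChar.map_add_eq_mul, AddChar.map_neg_eq_conj]
  rw [← Complex.normSq_eq_norm_sq]
  calc Complex.normSq (∑ x, ψ (f x)) = ‖(Complex.normSq (∑ x, ψ (f x)) : ℂ)‖ := by
        rw [Complex.norm_of_nonneg (Complex.normSq_nonneg _)]
    _ ≤ _ := by
        rw [← Complex.mul_conj, h]
        exact norm_sum_le _ _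

theorem norm_sum_addChar_le_card (ψ : AddChar K ℂ) (f : K → K) :
    ‖∑ x, ψ (f x)‖ ≤ Fintype.card K := by
  refine (norm_sum_le _ _).trans ?_
  simp

theorem sum_addChar_eval_eq_zero {ψ : AddChar K ℂ} (hψ : ψ ≠ 1) {P : K[X]}
    (hP : P.natDegree = 1) : ∑ x, ψ (P.eval x) = 0 := by
  obtain ⟨a, ha, b, rfl⟩ := natDegree_eq_one.1 hP
  have h := AddChar.sum_eq_zero_of_ne_one (AddChar.IsPrimitive.of_ne_one hψ ha)
  simp only [AddChar.mulShift_apply] at h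
  simp [AddChar.map_add_eq_mul, ← Finset.sum_mul, h]

variable {p : ℕ} [Fact p.Prime] [CharP K p]

/-- Induction on `k`, squaring the sum at each step. Shifts that are roots of `linearCoeffPoly` get
the trivial bound; for the others the reduced difference is again admissible with `k` one smaller.
-/
theorem norm_sum_addChar_reduced_le {ψ : AddChar K ℂ} (hψ1 : ψ ≠ 1) (hψ : ∀ x, ψ (x ^ p) = ψ x)
    {d : ℕ} (k : ℕ) {P : K[X]} (hdeg : P.natDegree ≤ d) (hpos : 0 < P.natDegree)
    (hred : ∀ n, P.coeff n ≠ 0 → n ≠ 0 → ¬ p ∣ n)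
    (hs : ∀ n, P.coeff n ≠ 0 → (p.digits n).sum ≤ k + 1) :
    ‖∑ x, ψ (P.eval x)‖ ≤ (1 + d ^ 2) * (Fintype.card K : ℝ) ^ (1 - 1 / 2 ^ k : ℝ) := by
  have hprime : p.Prime := Fact.out
  have hlc : P.coeff P.natDegree ≠ 0 := by
    rw [← leadingCoeff, leadingCoeff_ne_zero]
    rintro rfl
    simp at hpos
  have hpN := hred _ hlc hpos.ne'
  have hq1 : (1 : ℝ) ≤ Fintype.card K := by exact_mod_cast Fintype.card_pos
  have hq0 : (0 : ℝ) < Fintype.card K := by linarith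
  rcases Nat.lt_or_ge P.natDegree 2 with h2 | h2
  · rw [sum_addChar_eval_eq_zero hψ1 (by omega), norm_zero]
    positivity
  induction k generalizing P with
  | zero =>
    -- Digit sum one and `p ∤ n` force degree one, contrary to `h2`.
    exfalso
    have h1 := hs _ hlc
    rw [digits_sum_of_not_dvd hprime.one_lt hpN] at h1
    have := digits_sum_pos hprime.one_lt (n := P.natDegree - 1) (by omega)
    omega
  | succ k ih =>
    classical
    set q : ℝ := (Fintype.card K : ℝ)
    -- All exponents stay below `p ^ (J + 1)`, while `p ^ J ≤ d` keeps the number of bad shifts at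
    -- most `d ^ 2`.
    set J := Nat.log p d
    have hJ1 : p ^ J ≤ d := Nat.pow_log_le_self p (by omega)
    have hJ2 : d < p ^ (J + 1) := Nat.lt_pow_succ_log_self hprime.one_lt d
    set W := linearCoeffPoly p J P with hW
    have hW0 : W ≠ 0 := linearCoeffPoly_ne_zero J h2 hpN
    have hWd : (W.roots.toFinset.card : ℝ) ≤ d ^ 2 := by
      have h1 := (Multiset.toFinset_card_le _).trans (card_roots' W)
      have h3 := (natDegree_linearCoeffPoly_le (p := p) J P).trans (Nat.mul_le_mul hJ1 hdeg)
      rw [sq]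
      exact_mod_cast h1.trans h3
    have hroot : ∀ u, ‖∑ x, ψ (P.eval (x + u) - P.eval x)‖ ≤
        (1 + d ^ 2) * q ^ (1 - 1 / 2 ^ k : ℝ) + if u ∈ W.roots.toFinset then q else 0 := by
      intro u
      split_ifs with hu
      · refine (norm_sum_addChar_le_card ψ _).trans ?_
        have : 0 ≤ (1 + d ^ 2) * q ^ (1 - 1 / 2 ^ k : ℝ) := by positivity
        linarith
      · rw [add_zero]
        have hu' : W.eval u ≠ 0 := by
          intro h
          exact hu (by simp [hW0, h])
        rw [hW, eval_linearCoeffPoly] at hu'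
        have hT : (taylor u P - P).natDegree ≤ d := (natDegree_taylor_sub_le P u).trans hdeg
        set R := frobReduce p (p ^ (J + 1)) (taylor u P - P) with hR
        have hR1 : R.coeff 1 ≠ 0 := fun h => hu' (by rw [h, zero_pow (pow_pos hprime.pos _).ne'])
        have hRpos : 0 < R.natDegree := le_natDegree_of_ne_zero hR1
        have hRdeg : R.natDegree ≤ d := (natDegree_frobReduce_le _ _).trans hT
        have heq : ∀ x, ψ (P.eval (x + u) - P.eval x) = ψ (R.eval x) := fun x => by
          rw [addChar_eval_frobReduce hψ (hT.trans_lt hJ2), eval_sub, taylor_eval]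
        simp_rw [heq]
        have hRred : ∀ n, R.coeff n ≠ 0 → n ≠ 0 → ¬ p ∣ n := fun n hn hn0 =>
          not_dvd_of_coeff_frobReduce_ne_zero hn hn0
        have hRs : ∀ n, R.coeff n ≠ 0 → (p.digits n).sum ≤ k + 1 := fun n hn => by
          refine digits_sum_le_of_coeff_frobReduce_ne_zero (fun n hn => ?_) hn
          have := digits_sum_lt_of_coeff_taylor_sub_ne_zero (p := p) (k := k + 2)
            (fun n hn => Nat.lt_succ_iff.2 (hs n hn)) hn
          omega
        have hRlc : R.coeff R.natDegree ≠ 0 := by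
          rw [← leadingCoeff, leadingCoeff_ne_zero]
          rintro h
          simp [h] at hRpos
        rcases Nat.lt_or_ge R.natDegree 2 with h3 | h3
        · rw [sum_addChar_eval_eq_zero hψ1 (by omega), norm_zero]
          positivity
        · exact ih hRdeg hRpos hRred hRs hRlc (hRred _ hRlc hRpos.ne') h3
    have hexp : (2 : ℝ) * (1 - 1 / 2 ^ (k + 1)) = 1 + (1 - 1 / 2 ^ k) := by
      field_simp
      ring
    have hsq : ((1 + d ^ 2) * q ^ (1 - 1 / 2 ^ (k + 1) : ℝ)) ^ 2 =
        (1 + d ^ 2) ^ 2 * (q * q ^ (1 - 1 / 2 ^ k : ℝ)) := by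
      rw [mul_pow, ← Real.rpow_natCast (q ^ _), ← Real.rpow_mul hq0.le, mul_comm _ ((2 : ℕ) : ℝ),
        Nat.cast_ofNat, hexp, Real.rpow_add hq0, Real.rpow_one]
    refine le_of_sq_le_sq ?_ (by positivity)
    rw [hsq]
    refine (sq_norm_sum_addChar_le ψ _).trans ((Finset.sum_le_sum fun u _ => hroot u).trans ?_)
    rw [Finset.sum_add_distrib, Finset.sum_const, Finset.sum_ite_mem, Finset.univ_inter,
      Finset.sum_const, Finset.card_univ, nsmul_eq_mul, nsmul_eq_mul]
    have hge : (1 : ℝ) ≤ q ^ (1 - 1 / 2 ^ k : ℝ) := by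
      refine Real.one_le_rpow hq1 (sub_nonneg.2 ?_)
      exact div_le_one_of_le₀ (one_le_pow₀ one_le_two) (by positivity)
    set Y : ℝ := q ^ (1 - 1 / 2 ^ k : ℝ)
    have h5 : (W.roots.toFinset.card : ℝ) * q ≤ d ^ 2 * (q * Y) :=
      mul_le_mul hWd (le_mul_of_one_le_right hq0.le hge) hq0.le (by positivity)
    -- This slack completes the square, so the constant `1 + d ^ 2` does not grow with `k`.
    have h6 : 0 ≤ (d : ℝ) ^ 4 * (q * Y) := by positivity
    calc q * ((1 + d ^ 2) * Y) + W.roots.toFinset.card * q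
        ≤ q * ((1 + d ^ 2) * Y) + d ^ 2 * (q * Y) + d ^ 4 * (q * Y) := by linarith
      _ = (1 + d ^ 2) ^ 2 * (q * Y) := by ring

/-- Every character is a multiplicative shift of the Frobenius-invariant one. The hypothesis at `x₀`
keeps the reduced polynomial nonconstant, excluding cases like `x ^ p - x`. -/
theorem norm_sum_addChar_le (χ : AddChar K ℂ) {d : ℕ} (k : ℕ) {P : K[X]} (hdeg : P.natDegree ≤ d)
    (hs : ∀ n, P.coeff n ≠ 0 → (p.digits n).sum ≤ k + 1) {x₀ : K}
    (hx₀ : χ (P.eval x₀) ≠ χ (P.eval 0)) :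
    ‖∑ x, χ (P.eval x)‖ ≤ (1 + d ^ 2) * (Fintype.card K : ℝ) ^ (1 - 1 / 2 ^ k : ℝ) := by
  obtain ⟨ψ, hψ1, hψ⟩ := exists_addChar_frobenius_invariant (K := K) (p := p)
  obtain ⟨a, rfl⟩ := exists_eq_mulShift hψ1 χ
  have hT : (C a * P).natDegree ≤ d := (natDegree_C_mul_le _ _).trans hdeg
  set R := frobReduce p (d + 1) (C a * P) with hR
  have heq : ∀ x, ψ.mulShift a (P.eval x) = ψ (R.eval x) := fun x => by
    rw [addChar_eval_frobReduce hψ (Nat.lt_succ_iff.2 hT), AddChar.mulShift_apply, eval_mul, eval_C]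
  rw [heq, heq] at hx₀
  simp_rw [heq]
  refine norm_sum_addChar_reduced_le hψ1 hψ k ((natDegree_frobReduce_le _ _).trans hT) ?_
    (fun n hn hn0 => not_dvd_of_coeff_frobReduce_ne_zero hn hn0) fun n hn =>
    digits_sum_le_of_coeff_frobReduce_ne_zero
      (fun n hn => hs n fun h => hn (by rw [coeff_C_mul, h, mul_zero])) hn
  refine Nat.pos_of_ne_zero fun h => hx₀ ?_
  rw [eq_C_of_natDegree_eq_zero h, eval_C, eval_C]

end Weyl

/-! ### Counting solutions with characters -/

section CharacterCount

variable {G : Type*} [AddCommGroup G] [Fintype G]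

theorem card_mul_card_solutions (f : Fin 3 → G → G) (c : G) :
    (Fintype.card G : ℂ) *
        (Nat.card {v : G × G × G // f 0 v.1 + f 1 v.2.1 + f 2 v.2.2 = c} : ℂ) =
      ∑ χ : AddChar G ℂ,
        (∑ x, χ (f 0 x)) * (∑ x, χ (f 1 x)) * (∑ x, χ (f 2 x)) * χ (-c) := by
  classical
  have h : ∀ χ : AddChar G ℂ,
      (∑ x, χ (f 0 x)) * (∑ x, χ (f 1 x)) * (∑ x, χ (f 2 x)) * χ (-c) =
        ∑ v : G × G × G, χ (f 0 v.1 + f 1 v.2.1 + f 2 v.2.2 + -c) := by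
    intro χ
    simp_rw [Fintype.sum_prod_type, AddChar.map_add_eq_mul, ← Finset.sum_mul, ← Finset.mul_sum,
      ← Finset.sum_mul, Finset.sum_mul_sum]
  simp_rw [h]
  rw [Finset.sum_comm]
  simp_rw [AddChar.sum_apply_eq_ite, add_neg_eq_zero]
  rw [← Finset.sum_filter, Finset.sum_const, Nat.card_eq_fintype_card, Fintype.card_subtype,
    nsmul_eq_mul, mul_comm]

/-- Orthogonality turns the second moment into the number of pairs with `f x = f y`. -/
theorem sum_normSq_sum_addChar_le {f : G → G} {D : ℕ} (hf : ∀ c, {x | f x = c}.ncard ≤ D) :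
    ∑ χ : AddChar G ℂ, ‖∑ x, χ (f x)‖ ^ 2 ≤ (Fintype.card G : ℝ) * (D * Fintype.card G) := by
  classical
  have h : ∀ χ : AddChar G ℂ, ((‖∑ x, χ (f x)‖ ^ 2 : ℝ) : ℂ) = ∑ y, ∑ x, χ (f x - f y) := by
    intro χ
    rw [← Complex.normSq_eq_norm_sq, ← Complex.mul_conj, map_sum, Finset.sum_mul_sum,
      Finset.sum_comm]
    simp_rw [sub_eq_add_neg, AddChar.map_add_eq_mul, AddChar.map_neg_eq_conj]
  have h2 : ((∑ χ : AddChar G ℂ, ‖∑ x, χ (f x)‖ ^ 2 : ℝ) : ℂ) =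
      ((∑ y, (Fintype.card G : ℝ) * {x | f x = f y}.ncard : ℝ) : ℂ) := by
    push_cast
    have h' := fun χ => h χ
    push_cast at h'
    simp_rw [h']
    rw [Finset.sum_comm]
    refine Finset.sum_congr rfl fun y _ => ?_
    rw [Finset.sum_comm]
    simp_rw [AddChar.sum_apply_eq_ite, sub_eq_zero]
    rw [← Finset.sum_filter, Finset.sum_const, nsmul_eq_mul, mul_comm, Set.ncard_eq_toFinset_card']
    simp
  rw [Complex.ofReal_injective h2, ← Finset.mul_sum]
  refine mul_le_mul_of_nonneg_left ?_ (by positivity)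
  refine (Finset.sum_le_card_nsmul _ _ (D : ℝ) fun y _ => by exact_mod_cast hf _).trans ?_
  rw [nsmul_eq_mul, Finset.card_univ, mul_comm]

open Classical in
theorem card_mul_card_annihilator (H : AddSubgroup G) :
    (Nat.card H : ℂ) * ∑ χ : AddChar G ℂ, (if ∀ h ∈ H, χ h = 1 then 1 else 0) =
      Fintype.card G := by
  have h : ∀ χ : AddChar G ℂ, (Nat.card H : ℂ) * (if ∀ h ∈ H, χ h = 1 then 1 else 0) =
      ∑ h : H, χ h := by
    intro χ
    have := AddChar.sum_eq_ite (χ.compAddMonoidHom H.subtype)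
    simp only [AddChar.compAddMonoidHom_apply, AddSubgroup.coe_subtype] at this
    rw [this, Nat.card_eq_fintype_card]
    simp [AddChar.eq_zero_iff]
  rw [Finset.mul_sum]
  simp_rw [h]
  rw [Finset.sum_comm]
  simp_rw [AddChar.sum_apply_eq_ite]
  simp

theorem abs_card_solutions_sub_le {f : Fin 3 → G → G} {H : AddSubgroup G}
    (hfH : ∀ i x, f i x ∈ H) {c : G} (hc : c ∈ H) {D : ℕ} {B : ℝ} (hB0 : 0 ≤ B)
    (hfib : ∀ i c, {x | f i x = c}.ncard ≤ D)
    (hB : ∀ χ : AddChar G ℂ, (∃ h ∈ H, χ h ≠ 1) → ∃ i, ‖∑ x, χ (f i x)‖ ≤ B) :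
    |(Nat.card {v : G × G × G // f 0 v.1 + f 1 v.2.1 + f 2 v.2.2 = c} : ℝ) -
        (Fintype.card G : ℝ) ^ 3 / (Nat.card H : ℝ)| ≤ 3 * B * (D * Fintype.card G) := by
  classical
  set q : ℝ := (Fintype.card G : ℝ) with hq
  set N := Nat.card {v : G × G × G // f 0 v.1 + f 1 v.2.1 + f 2 v.2.2 = c} with hN
  have hq0 : 0 < q := by
    rw [hq]
    exact_mod_cast Fintype.card_pos
  have hH0 : (Nat.card H : ℂ) ≠ 0 := by exact_mod_cast Nat.card_pos.ne'
  set S : Fin 3 → AddChar G ℂ → ℂ := fun i χ => ∑ x, χ (f i x) with hS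
  have hmain : (q : ℂ) * (N - q ^ 3 / Nat.card H) = ∑ χ : AddChar G ℂ,
      (if ∀ h ∈ H, χ h = 1 then 0 else S 0 χ * S 1 χ * S 2 χ * χ (-c)) := by
    have h1 : (q : ℂ) * (q ^ 3 / Nat.card H) = ∑ χ : AddChar G ℂ,
        (if ∀ h ∈ H, χ h = 1 then S 0 χ * S 1 χ * S 2 χ * χ (-c) else 0) := by
      have h2 : ∀ χ : AddChar G ℂ,
          (if ∀ h ∈ H, χ h = 1 then S 0 χ * S 1 χ * S 2 χ * χ (-c) else 0) =
            (q : ℂ) ^ 3 * (if ∀ h ∈ H, χ h = 1 then 1 else 0) := by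
        intro χ
        split_ifs with hχ
        · have hS' : ∀ i, S i χ = q := fun i => by
            simp only [hS, hχ _ (hfH i _)]
            simp [hq]
          rw [hS', hS', hS', hχ _ (neg_mem hc)]
          ring
        · simp
      simp_rw [h2]
      rw [← Finset.mul_sum]
      have h3 := card_mul_card_annihilator H
      rw [show (Fintype.card G : ℂ) = (q : ℂ) by simp [hq]] at h3
      field_simp
      linear_combination -(q : ℂ) ^ 3 * h3
    rw [mul_sub, h1, show (q : ℂ) = (Fintype.card G : ℂ) by simp [hq], card_mul_card_solutions,
      ← Finset.sum_sub_distrib]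
    refine Finset.sum_congr rfl fun χ _ => ?_
    split_ifs <;> simp [hS]
  have hterm : ∀ χ : AddChar G ℂ,
      ‖(if ∀ h ∈ H, χ h = 1 then 0 else S 0 χ * S 1 χ * S 2 χ * χ (-c))‖ ≤
        B * ∑ i, ‖S i χ‖ ^ 2 := by
    intro χ
    split_ifs with hχ
    · rw [norm_zero]
      positivity
    · push Not at hχ
      obtain ⟨i, hi⟩ := hB χ hχ
      rw [norm_mul, norm_mul, norm_mul, AddChar.norm_apply, mul_one, Fin.sum_univ_three]
      change ‖S i χ‖ ≤ B at hi
      -- Bounding `b * e` by all three squares makes the estimate independent of which factor is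
      -- small.
      have key : ∀ a b e : ℝ, 0 ≤ a → 0 ≤ b → 0 ≤ e → a ≤ B →
          a * (b * e) ≤ B * (a ^ 2 + b ^ 2 + e ^ 2) := fun a b e ha hb he hab =>
        mul_le_mul hab (by nlinarith [sq_nonneg (b - e), sq_nonneg a, sq_nonneg b, sq_nonneg e])
          (mul_nonneg hb he) hB0
      have n0 := norm_nonneg (S 0 χ)
      have n1 := norm_nonneg (S 1 χ)
      have n2 := norm_nonneg (S 2 χ)
      fin_cases i
      · exact (mul_assoc _ _ _).trans_le (key _ _ _ n0 n1 n2 hi)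
      · refine (Eq.trans_le ?_ (key _ _ _ n1 n0 n2 hi)).trans_eq ?_ <;> ring
      · refine (Eq.trans_le ?_ (key _ _ _ n2 n0 n1 hi)).trans_eq ?_ <;> ring
  have hnorm : q * |(N : ℝ) - q ^ 3 / Nat.card H| ≤ q * (3 * B * (D * q)) := by
    calc q * |(N : ℝ) - q ^ 3 / Nat.card H| = ‖(q : ℂ) * (N - q ^ 3 / Nat.card H)‖ := by
          rw [norm_mul, Complex.norm_of_nonneg hq0.le, ← Complex.ofReal_natCast N,
            ← Complex.ofReal_natCast (Nat.card H), ← Complex.ofReal_pow, ← Complex.ofReal_div,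
            ← Complex.ofReal_sub, Complex.norm_real, Real.norm_eq_abs]
      _ ≤ ∑ χ : AddChar G ℂ, B * ∑ i, ‖S i χ‖ ^ 2 := by
          rw [hmain]
          exact (norm_sum_le _ _).trans (Finset.sum_le_sum fun χ _ => hterm χ)
      _ = B * ∑ i, ∑ χ : AddChar G ℂ, ‖S i χ‖ ^ 2 := by rw [← Finset.mul_sum, Finset.sum_comm]
      _ ≤ B * ∑ _i : Fin 3, q * (D * q) := by
          refine mul_le_mul_of_nonneg_left (Finset.sum_le_sum fun i _ => ?_) hB0
          exact sum_normSq_sum_addChar_le (hfib i)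
      _ = q * (3 * B * (D * q)) := by
          rw [Finset.sum_const, Finset.card_univ, Fintype.card_fin, nsmul_eq_mul]
          push_cast
          ring
  exact le_of_mul_le_mul_left hnorm hq0

end CharacterCount

/-! ### Specialisation to residue fields -/

section Residue

variable {F : Type*} [Field F]

theorem savingExponent_pos (k : Fin 3 → ℕ) : 0 < savingExponent k := by
  obtain ⟨i, hi⟩ := exists_eq_ciInf_of_finite (f := fun i => (1 : ℝ) / 2 ^ (k i - 1))
  rw [savingExponent, ← hi]
  positivity

theorem savingExponent_le (k : Fin 3 → ℕ) (i : Fin 3) : savingExponent k ≤ 1 / 2 ^ (k i - 1) :=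
  ciInf_le (Set.finite_range _).bddBelow i

theorem savingExponent_le_one (k : Fin 3 → ℕ) : savingExponent k ≤ 1 :=
  (savingExponent_le k 0).trans
    (div_le_one_of_le₀ (one_le_pow₀ one_le_two) (by positivity))

theorem finite_polyMod [Finite F] {Q : F[X]} (hQ : Q.Monic) : Finite (PolyMod Q) :=
  have := hQ.finite_quotient
  Module.finite_of_finite F

theorem card_polyMod [Finite F] {Q : F[X]} (hQ : Q.Monic) :
    Nat.card (PolyMod Q) = Nat.card F ^ Q.natDegree := by
  have := hQ.finite_quotient
  rw [Module.natCard_eq_pow_finrank (K := F), finrank_quotient_span_eq_natDegree]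

theorem polyFun_mem_valueSubgroup (Q : F[X]) (P : Fin 3 → F[X][X]) (i : Fin 3) (x : PolyMod Q) :
    polyFun Q (P i) x ∈ valueSubgroup Q P :=
  AddSubgroup.mem_iSup_of_mem i (AddSubgroup.subset_closure ⟨x, rfl⟩)

/-- The kernel of `χ` is a subgroup, so it contains the generated group once it contains all values.
-/
theorem exists_ne_one_of_valueSubgroup {Q : F[X]} {P : Fin 3 → F[X][X]}
    {χ : AddChar (PolyMod Q) ℂ} (h : ∃ g ∈ valueSubgroup Q P, χ g ≠ 1) :
    ∃ i x, χ (polyFun Q (P i) x) ≠ 1 := by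
  by_contra! hc
  obtain ⟨g, hg, hne⟩ := h
  have hle : valueSubgroup Q P ≤ χ.toAddMonoidHom.ker := by
    refine iSup_le fun i => (AddSubgroup.closure_le _).2 ?_
    rintro _ ⟨x, rfl⟩
    exact hc i x
  exact hne (hle hg)

theorem polyFun_eq_eval_map (Q : F[X]) (P : F[X][X]) (x : PolyMod Q) :
    polyFun Q P x = (P.map (Ideal.Quotient.mk (Ideal.span {Q}))).eval x :=
  (eval_map _ _).symm

theorem polyFun_zero {Q : F[X]} {P : F[X][X]} (h0 : P.eval 0 = 0) : polyFun Q P 0 = 0 := by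
  rw [polyFun, eval₂_at_zero, coeff_zero_eq_eval_zero, h0, map_zero]

/-- Since `Q` divides no leading coefficient, degrees survive reduction and fibres have at most `D`
points. -/
theorem abs_solutionCount_sub_le [Finite F] {P : Fin 3 → F[X][X]} {k : Fin 3 → ℕ} {D : ℕ}
    (hpos : ∀ i, 0 < (P i).natDegree) (h0 : ∀ i, (P i).eval 0 = 0)
    (hdeg : ∀ i, (P i).natDegree ≤ D) (hk : ∀ i, derivationalDegree (P i) = k i)
    {Q : F[X]} (hQ : Q.Monic) (hirr : Irreducible Q) (hlc : ∀ i, ¬ Q ∣ (P i).leadingCoeff)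
    {c : PolyMod Q} (hc : c ∈ valueSubgroup Q P) :
    |(solutionCount Q P c : ℝ)
        - (Nat.card (PolyMod Q) : ℝ) ^ 3 / (Nat.card (valueSubgroup Q P) : ℝ)| ≤
      3 * (1 + D ^ 2) * D * (Nat.card (PolyMod Q) : ℝ) ^ (2 - savingExponent k) := by
  classical
  have hmax : (Ideal.span {Q}).IsMaximal := PrincipalIdealRing.isMaximal_of_irreducible hirr
  let _ : Field (PolyMod Q) := Ideal.Quotient.field (Ideal.span {Q})
  have := finite_polyMod hQ
  let _ : Fintype (PolyMod Q) := Fintype.ofFinite _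
  obtain ⟨p, hcF⟩ := CharP.exists F
  have hp : Fact p.Prime := ⟨CharP.char_is_prime F p⟩
  set φ := Ideal.Quotient.mk (Ideal.span {Q}) with hφ
  have hcK : CharP (PolyMod Q) p := charP_of_injective_ringHom (φ.comp C).injective p
  rw [Nat.card_eq_fintype_card (α := PolyMod Q)]
  set q : ℝ := (Fintype.card (PolyMod Q) : ℝ) with hq
  have hq1 : 1 ≤ q := by
    rw [hq]
    exact_mod_cast Fintype.card_pos
  have hq0 : 0 < q := by linarith
  have hndeg : ∀ i, ((P i).map φ).natDegree = (P i).natDegree := fun i =>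
    natDegree_map_of_leadingCoeff_ne_zero _ fun h =>
      hlc i (Ideal.mem_span_singleton.1 (Ideal.Quotient.eq_zero_iff_mem.1 h))
  have h := abs_card_solutions_sub_le (f := fun i => polyFun Q (P i)) (D := D)
    (B := (1 + D ^ 2) * q ^ (1 - savingExponent k)) (polyFun_mem_valueSubgroup Q P) hc
    (by positivity) (fun i c => ?_) (fun χ hχ => ?_)
  · refine h.trans_eq ?_
    rw [show 2 - savingExponent k = (1 - savingExponent k) + 1 by ring, Real.rpow_add hq0,
      Real.rpow_one]
    ring
  · have hR : ((P i).map φ - C c).natDegree = (P i).natDegree := by rw [natDegree_sub_C, hndeg]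
    have hne : (P i).map φ - C c ≠ 0 := fun h => (hpos i).ne' (by rw [← hR, h, natDegree_zero])
    have hsub : {x | polyFun Q (P i) x = c} ⊆ ((P i).map φ - C c).roots.toFinset := fun x hx => by
      rw [Set.mem_ofPred_eq, polyFun_eq_eval_map] at hx
      rw [Finset.mem_coe, Multiset.mem_toFinset, mem_roots hne, IsRoot.def, eval_sub, eval_C, hx,
        sub_self]
    refine (Set.ncard_le_ncard hsub (Finset.finite_toSet _)).trans ?_
    rw [Set.ncard_coe_finset]
    exact (Multiset.toFinset_card_le _).trans ((card_roots' _).trans (hR.trans_le (hdeg i)))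
  · obtain ⟨i, x, hx⟩ := exists_ne_one_of_valueSubgroup hχ
    refine ⟨i, ?_⟩
    simp_rw [polyFun_eq_eval_map]
    refine (norm_sum_addChar_le (p := p) χ (d := D) (k i - 1) (P := (P i).map φ)
      ((hndeg i).trans_le (hdeg i)) (fun n hn => ?_) (x₀ := x) ?_).trans ?_
    · have := digits_sum_le_derivationalDegree (p := p) (P i) (n := n) fun h =>
        hn (by rw [coeff_map, h, map_zero])
      rw [hk] at this
      omega
    · rwa [← polyFun_eq_eval_map, ← polyFun_eq_eval_map, polyFun_zero (h0 i),
        AddChar.map_zero_eq_one]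
    · refine mul_le_mul_of_nonneg_left ?_ (by positivity)
      exact Real.rpow_le_rpow_of_exponent_le hq1 (sub_le_sub_left (savingExponent_le k i) 1)

theorem abs_solutionCount_sub_le_cube [Finite F] (P : Fin 3 → F[X][X]) {Q : F[X]} (hQ : Q.Monic)
    (c : PolyMod Q) :
    |(solutionCount Q P c : ℝ)
        - (Nat.card (PolyMod Q) : ℝ) ^ 3 / (Nat.card (valueSubgroup Q P) : ℝ)| ≤
      (Nat.card (PolyMod Q) : ℝ) ^ 3 := by
  have := finite_polyMod hQ
  have h1 : (solutionCount Q P c : ℝ) ≤ (Nat.card (PolyMod Q) : ℝ) ^ 3 := by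
    have h := Finite.card_subtype_le (fun v : PolyMod Q × PolyMod Q × PolyMod Q =>
      polyFun Q (P 0) v.1 + polyFun Q (P 1) v.2.1 + polyFun Q (P 2) v.2.2 = c)
    rw [Nat.card_prod, Nat.card_prod] at h
    rw [pow_three]
    exact_mod_cast h
  have h2 : (Nat.card (PolyMod Q) : ℝ) ^ 3 / (Nat.card (valueSubgroup Q P) : ℝ) ≤
      (Nat.card (PolyMod Q) : ℝ) ^ 3 :=
    div_le_self (by positivity) (by exact_mod_cast Nat.card_pos)
  exact abs_sub_le_of_nonneg_of_le (by positivity) h1 (by positivity) h2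

theorem not_dvd_leadingCoeff_of_card_lt [Finite F] {P : F[X][X]} (hP : 0 < P.natDegree) {Q : F[X]}
    (hQ : Q.Monic) (h : Nat.card F ^ P.leadingCoeff.natDegree < Nat.card (PolyMod Q)) :
    ¬ Q ∣ P.leadingCoeff := by
  intro hd
  rw [card_polyMod hQ] at h
  refine absurd (Nat.pow_le_pow_right Nat.card_pos (natDegree_le_of_dvd hd ?_)) (not_le.2 h)
  rw [Ne, leadingCoeff_eq_zero]
  rintro rfl
  simp at hP

/-- As `|H_q| ≤ q`, the main term is at least `q ^ 2`, which beats the error. -/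
theorem sum_ranges_eq_valueSubgroup [Finite F] {P : Fin 3 → F[X][X]} {k : Fin 3 → ℕ} {B : ℝ}
    {Q : F[X]} (hQ : Q.Monic) (hB : B < (Nat.card (PolyMod Q) : ℝ) ^ savingExponent k)
    (h : ∀ c ∈ valueSubgroup Q P, |(solutionCount Q P c : ℝ)
        - (Nat.card (PolyMod Q) : ℝ) ^ 3 / (Nat.card (valueSubgroup Q P) : ℝ)| ≤
      B * (Nat.card (PolyMod Q) : ℝ) ^ (2 - savingExponent k)) :
    Set.range (polyFun Q (P 0)) + Set.range (polyFun Q (P 1)) + Set.range (polyFun Q (P 2))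
      = (valueSubgroup Q P : Set (PolyMod Q)) := by
  have := finite_polyMod hQ
  refine Set.Subset.antisymm ?_ fun c hc => ?_
  · rintro _ ⟨_, ⟨_, ⟨x, rfl⟩, _, ⟨y, rfl⟩, rfl⟩, _, ⟨z, rfl⟩, rfl⟩
    exact add_mem (add_mem (polyFun_mem_valueSubgroup Q P 0 x) (polyFun_mem_valueSubgroup Q P 1 y))
      (polyFun_mem_valueSubgroup Q P 2 z)
  · have hq0 : (0 : ℝ) < Nat.card (PolyMod Q) := by exact_mod_cast Nat.card_pos
    have hH0 : (0 : ℝ) < Nat.card (valueSubgroup Q P) := by exact_mod_cast Nat.card_pos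
    have hHq : (Nat.card (valueSubgroup Q P) : ℝ) ≤ Nat.card (PolyMod Q) := by
      exact_mod_cast AddSubgroup.card_le_card_addGroup _
    set q : ℝ := (Nat.card (PolyMod Q) : ℝ)
    have h1 : q ^ 2 ≤ q ^ 3 / (Nat.card (valueSubgroup Q P) : ℝ) := by
      rw [le_div_iff₀ hH0, pow_succ q 2]
      exact mul_le_mul_of_nonneg_left hHq (by positivity)
    have h2 : B * q ^ (2 - savingExponent k) < q ^ 2 := by
      calc B * q ^ (2 - savingExponent k)
          < q ^ savingExponent k * q ^ (2 - savingExponent k) :=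
            mul_lt_mul_of_pos_right hB (Real.rpow_pos_of_pos hq0 _)
        _ = q ^ 2 := by
            rw [← Real.rpow_add hq0, add_sub_cancel, Real.rpow_ofNat]
    have h3 := (abs_le.1 (h c hc)).1
    have h4 : (0 : ℝ) < solutionCount Q P c := by linarith
    have h5 : 0 < solutionCount Q P c := by exact_mod_cast h4
    obtain ⟨⟨⟨x, y, z⟩, hv⟩⟩ := (Nat.card_pos_iff.1 h5).1
    exact ⟨_, ⟨_, ⟨x, rfl⟩, _, ⟨y, rfl⟩, rfl⟩, _, ⟨z, rfl⟩, hv⟩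

end Residue

/-! ### Assembling the constants -/

theorem mainTheorem9 (d k : Fin 3 → ℕ) :
    ∃ C : ℝ, 0 < C ∧ ∀ (F : Type*) [Field F] [Finite F] (P : Fin 3 → F[X][X]),
      (∀ i, 0 < (P i).natDegree) →
      (∀ i, (P i).eval 0 = 0) →
      (∀ i, (P i).natDegree = d i) →
      (∀ i, derivationalDegree (P i) = k i) →
      0 < savingExponent k ∧
      (∃ q₀ : ℕ, ∀ Q : F[X], Q.Monic → Irreducible Q → q₀ ≤ Nat.card (PolyMod Q) →
        ∀ c ∈ valueSubgroup Q P,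
          |(solutionCount Q P c : ℝ)
              - (Nat.card (PolyMod Q) : ℝ) ^ 3 / (Nat.card (valueSubgroup Q P) : ℝ)|
            ≤ C * (Nat.card (PolyMod Q) : ℝ) ^ (2 - savingExponent k)) ∧
      (∃ C' : ℝ, ∀ Q : F[X], Q.Monic → Irreducible Q →
        ∀ c ∈ valueSubgroup Q P,
          |(solutionCount Q P c : ℝ)
              - (Nat.card (PolyMod Q) : ℝ) ^ 3 / (Nat.card (valueSubgroup Q P) : ℝ)|
            ≤ C' * (Nat.card (PolyMod Q) : ℝ) ^ (2 - savingExponent k)) ∧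
      (∃ q₁ : ℕ, ∀ Q : F[X], Q.Monic → Irreducible Q → q₁ ≤ Nat.card (PolyMod Q) →
        Set.range (polyFun Q (P 0)) + Set.range (polyFun Q (P 1)) + Set.range (polyFun Q (P 2))
          = (valueSubgroup Q P : Set (PolyMod Q))) := by
  -- The `+ 1` makes the constant positive whatever `d` is.
  set D := ∑ i, d i + 1 with hD
  refine ⟨3 * (1 + D ^ 2) * D, by positivity, fun F _ _ P hpos h0 hd hk => ?_⟩
  set C : ℝ := 3 * (1 + D ^ 2) * D with hC
  have hdeg : ∀ i, (P i).natDegree ≤ D := fun i => by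
    rw [hd]
    exact (Finset.single_le_sum (fun _ _ => Nat.zero_le _) (Finset.mem_univ i)).trans
      (Nat.le_succ _)
  set q₀ := ∑ i, Nat.card F ^ (P i).leadingCoeff.natDegree + 1 with hq₀
  have hlarge : ∀ Q : F[X], Q.Monic → Irreducible Q → q₀ ≤ Nat.card (PolyMod Q) →
      ∀ c ∈ valueSubgroup Q P, |(solutionCount Q P c : ℝ)
          - (Nat.card (PolyMod Q) : ℝ) ^ 3 / (Nat.card (valueSubgroup Q P) : ℝ)|
        ≤ C * (Nat.card (PolyMod Q) : ℝ) ^ (2 - savingExponent k) := by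
    intro Q hQ hirr hq c hc
    refine abs_solutionCount_sub_le hpos h0 hdeg hk hQ hirr (fun i => ?_) hc
    refine not_dvd_leadingCoeff_of_card_lt (hpos i) hQ (lt_of_lt_of_le (Nat.lt_succ_of_le ?_) hq)
    exact Finset.single_le_sum (f := fun i => Nat.card F ^ (P i).leadingCoeff.natDegree)
      (fun _ _ => Nat.zero_le _) (Finset.mem_univ i)
  -- For `q ≤ q₀` the error is trivially at most `q₀ ^ 3`, and `q ^ (2 - γ) ≥ 1` because `γ ≤ 1`.
  refine ⟨savingExponent_pos k, ⟨q₀, hlarge⟩, ⟨max C (q₀ ^ 3), fun Q hQ hirr c hc => ?_⟩, ?_⟩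
  · have := finite_polyMod hQ
    have hq1 : (1 : ℝ) ≤ Nat.card (PolyMod Q) := by exact_mod_cast Nat.card_pos
    rcases le_total q₀ (Nat.card (PolyMod Q)) with hq | hq
    · exact (hlarge Q hQ hirr hq c hc).trans
        (mul_le_mul_of_nonneg_right (le_max_left _ _) (by positivity))
    · refine (abs_solutionCount_sub_le_cube P hQ c).trans ?_
      have h1 : (Nat.card (PolyMod Q) : ℝ) ^ 3 ≤ (q₀ : ℝ) ^ 3 := by gcongr
      have h2 : (1 : ℝ) ≤ (Nat.card (PolyMod Q) : ℝ) ^ (2 - savingExponent k) :=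
        Real.one_le_rpow hq1 (by linarith [savingExponent_le_one k])
      exact (h1.trans (le_max_right C _)).trans
        (le_mul_of_one_le_right (le_max_of_le_right (by positivity)) h2)
  · have htend := (tendsto_rpow_atTop (savingExponent_pos k)).comp
      (tendsto_natCast_atTop_atTop (R := ℝ))
    obtain ⟨n₀, hn₀⟩ := Filter.eventually_atTop.1 (htend.eventually_gt_atTop C)
    refine ⟨max q₀ n₀, fun Q hQ hirr hq => ?_⟩
    exact sum_ranges_eq_valueSubgroup hQ (hn₀ _ ((le_max_right _ _).trans hq))
      (hlarge Q hQ hirr ((le_max_left _ _).trans hq))
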